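/- A group extension $1\to H\xrightarrow{\iota} G\xrightarrow{\pi} K\to 1$ is called a \emph{direct extension} if it is equivalent to the direct product extension $1\to H\to H\times K\to K\to 1$, that is, if there is an isomorphism $\theta: G\to H\times K$ with $\theta(\iota(h))=(h,1)$ for all $h\in H$ and $\mathrm{pr}_K\circ\theta=\pi$. A decomposition $G=H.K$ of a group $G$ into direct factors means that $H$ and $K$ are normal subgroups of $G$ such that every element of $G$ is a product $hk$ with $h\in H$, $k\in K$, and $H\cap K=1$. (1) Let $G$, $H$ and $K$ be finite groups such that $G\cong H\times K$. Then every group extension $1\to H\to G\to K\to 1$ is a direct extension. (2) Equivalently: let $G=H.K$ be a decomposition of a finite group $G$ into direct factors, and let $H_0$ be a normal subgroup of $G$ such that $H_0\cong H$ and $G/H_0\cong K$. Then $H_0$ is a direct factor of $G$: there is a normal subgroup $K_0$ of $G$ such that $G=H_0.K_0$ and $H_0\cap K_0=1$. -/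

import Mathlib

/-- The direct product extension `1 → H → H × K → K → 1`, with `h ↦ (h, 1)` and `(h, k) ↦ k`. -/
def prodExtension (H K : Type*) [Group H] [Group K] : GroupExtension H (H × K) K where
  inl := MonoidHom.inl H K
  rightHom := MonoidHom.snd H K
  inl_injective := fun a b h => congrArg Prod.fst h
  range_inl_eq_ker_rightHom := by
    ext ⟨h, k⟩
    constructor
    · rintro ⟨a, ha⟩
      exact (congrArg Prod.snd ha).symm
    · intro hk
      exact ⟨h, Prod.ext rfl (Eq.symm hk)⟩
  rightHom_surjective := fun k => ⟨(1, k), rfl⟩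

/-- An extension `1 → H → G → K → 1` is direct if it is equivalent to the direct product
extension, i.e. if there is an isomorphism `G ≃* H × K` that commutes with the maps from `H` and
the maps to `K`. -/
def IsDirectExtension {H G K : Type*} [Group H] [Group G] [Group K]
    (S : GroupExtension H G K) : Prop :=
  Nonempty (S.Equiv (prodExtension H K))

/-- `G = H.K` is a decomposition of `G` into direct factors: `H` and `K` are normal subgroups,
every element of `G` is a product of an element of `H` and one of `K`, and `H ∩ K = 1`. -/
structure IsDirectDecomposition {G : Type*} [Group G] (H K : Subgroup G) : Prop where
  normal_left : H.Normal
  normal_right : K.Normal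
  mul_eq : ∀ g : G, ∃ h ∈ H, ∃ k ∈ K, h * k = g
  inf_eq_bot : H ⊓ K = ⊥

/-! The extension is direct once the identity of `K` lifts to a homomorphism into the centralizer of
`H` in `G`. Such central lifts exist for every `φ : Γ →* K`, by counting homomorphisms with large
centralizer. Among the `φ` without a central lift, take one whose centralizer has maximal order `d`.
Any `ψ : Γ →* G` with centralizer of order at least `|H| * d` lies over a map that does lift;
dividing by a fixed lift injects these `ψ` into the homomorphisms to `H × K` with the same bound. As
`G ≃* H × K`, both sets have the same finite size, so the injection is onto. It then hits `(1, φ)`,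
and `φ` lifts after all. -/

/-- The centralizer in `G` of the image of a homomorphism `Γ →* G`. -/
def rangeCentralizer {Γ G : Type*} [Group Γ] [Group G] (f : Γ →* G) : Subgroup G :=
  Subgroup.centralizer (Set.range f)

theorem mem_rangeCentralizer {Γ G : Type*} [Group Γ] [Group G] {f : Γ →* G} {g : G} :
    g ∈ rangeCentralizer f ↔ ∀ x, f x * g = g * f x := by
  simp [rangeCentralizer, Subgroup.mem_centralizer_iff]

theorem card_rangeCentralizer_prod {Γ H K : Type*} [Group Γ] [Group H] [Group K]
    (a : Γ →* H) (φ : Γ →* K) :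
    Nat.card (rangeCentralizer (a.prod φ)) =
      Nat.card (rangeCentralizer a) * Nat.card (rangeCentralizer φ) := by
  have h : rangeCentralizer (a.prod φ) = (rangeCentralizer a).prod (rangeCentralizer φ) := by
    ext ⟨h, k⟩
    simp [mem_rangeCentralizer, Subgroup.mem_prod, forall_and]
  rw [h, Nat.card_congr (Subgroup.prodEquiv _ _).toEquiv, Nat.card_prod]

theorem rangeCentralizer_one {Γ G : Type*} [Group Γ] [Group G] :
    rangeCentralizer (1 : Γ →* G) = ⊤ := by
  ext g
  simp [mem_rangeCentralizer]

theorem card_rangeCentralizer_mulEquiv_comp {Γ G G' : Type*} [Group Γ] [Group G] [Group G']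
    (e : G ≃* G') (f : Γ →* G) :
    Nat.card (rangeCentralizer (e.toMonoidHom.comp f)) = Nat.card (rangeCentralizer f) := by
  refine (Nat.card_congr (e.toEquiv.subtypeEquiv fun g => ?_)).symm
  simp only [mem_rangeCentralizer]
  refine forall_congr' fun x => ?_
  simp [← map_mul]

namespace GroupExtension

variable {Γ H G K : Type*} [Group Γ] [Group H] [Group G] [Group K]

theorem card_eq_comap_inl_mul_map_rightHom (S : GroupExtension H G K) (D : Subgroup G) :
    Nat.card D = Nat.card (D.comap S.inl) * Nat.card (D.map S.rightHom) := by
  let f : D →* K := S.rightHom.comp D.subtype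
  have hr : f.range = D.map S.rightHom := by
    rw [MonoidHom.range_comp, Subgroup.range_subtype]
  have hk : Nat.card (D.comap S.inl) = Nat.card f.ker := by
    refine Nat.card_congr (Equiv.ofBijective
      (fun h => ⟨⟨S.inl h.1, h.2⟩, S.rightHom_inl h.1⟩) ⟨fun x y hxy => ?_, ?_⟩)
    · exact Subtype.ext (S.inl_injective (congrArg (fun z => (z.1.1 : G)) hxy))
    · rintro ⟨⟨g, hg⟩, hgk⟩
      have hg' : g ∈ S.inl.range := by
        rw [S.range_inl_eq_ker_rightHom]
        exact hgk
      obtain ⟨h, rfl⟩ := hg'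
      exact ⟨⟨h, hg⟩, rfl⟩
  rw [hk, ← hr, ← Subgroup.index_ker, Subgroup.card_mul_index]

/-- The centralizer of `ψ` is an extension of its image in `K` by its part in `H`, and that image
centralizes the projection of `ψ`. -/
theorem card_rangeCentralizer_le [Finite K] (S : GroupExtension H G K) (ψ : Γ →* G) :
    Nat.card (rangeCentralizer ψ) ≤ Nat.card ((rangeCentralizer ψ).comap S.inl) *
      Nat.card (rangeCentralizer (S.rightHom.comp ψ)) := by
  rw [S.card_eq_comap_inl_mul_map_rightHom]
  refine Nat.mul_le_mul_left _ (Subgroup.card_le_of_le ?_)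
  rintro _ ⟨g, hg, rfl⟩
  rw [mem_rangeCentralizer]
  intro x
  simpa using congrArg S.rightHom (mem_rangeCentralizer.1 hg x)

/-- `ψ` lifts `φ : Γ →* K` to a homomorphism into the centralizer of the kernel `H`. -/
structure IsCentralLift (S : GroupExtension H G K) (φ : Γ →* K) (ψ : Γ →* G) : Prop where
  rightHom_comp : S.rightHom.comp ψ = φ
  commute : ∀ x h, Commute (ψ x) (S.inl h)

/-- Homomorphisms over the same `φ` differ from a central lift of `φ` by a homomorphism
into the kernel. -/
theorem IsCentralLift.exists_eq_inl_mul {S : GroupExtension H G K} {φ : Γ →* K} {ψ₀ ψ : Γ →* G}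
    (h₀ : S.IsCentralLift φ ψ₀) (hψ : S.rightHom.comp ψ = φ) :
    ∃ a : Γ →* H, ∀ x, ψ x = S.inl (a x) * ψ₀ x := by
  have hex : ∀ x, ∃ h, S.inl h = ψ x * (ψ₀ x)⁻¹ := by
    intro x
    have hmem : ψ x * (ψ₀ x)⁻¹ ∈ S.inl.range := by
      have h1 := DFunLike.congr_fun hψ x
      have h2 := DFunLike.congr_fun h₀.rightHom_comp x
      simp only [MonoidHom.comp_apply] at h1 h2
      rw [S.range_inl_eq_ker_rightHom, MonoidHom.mem_ker, map_mul, map_inv, h1, h2,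
        mul_inv_cancel]
    exact hmem
  choose a ha using hex
  refine ⟨MonoidHom.mk' a fun x y => S.inl_injective ?_, fun x => ?_⟩
  · have hc := (h₀.commute x (a y)).inv_left.eq
    rw [map_mul, ha x, mul_assoc, hc, ha y, ha (x * y), map_mul, map_mul, mul_inv_rev]
    simp only [mul_assoc]
  · simp [ha]

/-- The factor `ψ₀ x` commutes with the kernel, so only `a x` constrains an element of `H`. -/
theorem IsCentralLift.comap_rangeCentralizer {S : GroupExtension H G K} {φ : Γ →* K}
    {ψ₀ ψ : Γ →* G} (h₀ : S.IsCentralLift φ ψ₀) {a : Γ →* H}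
    (ha : ∀ x, ψ x = S.inl (a x) * ψ₀ x) :
    (rangeCentralizer ψ).comap S.inl = rangeCentralizer a := by
  ext h
  simp only [Subgroup.mem_comap, mem_rangeCentralizer]
  refine forall_congr' fun x => ?_
  rw [ha, mul_assoc, (h₀.commute x h).eq, ← mul_assoc, ← mul_assoc, mul_left_inj, ← map_mul,
    ← map_mul, S.inl_injective.eq_iff]

theorem isCentralLift_of_comap_rangeCentralizer_eq_top {S : GroupExtension H G K} {ψ : Γ →* G}
    (h : (rangeCentralizer ψ).comap S.inl = ⊤) : S.IsCentralLift (S.rightHom.comp ψ) ψ where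
  rightHom_comp := rfl
  commute x a := by
    have ha : a ∈ (rangeCentralizer ψ).comap S.inl := h ▸ Subgroup.mem_top a
    exact mem_rangeCentralizer.1 ha x

/-- If `G ≃* H × K`, then every homomorphism into `K` lifts to the centralizer of the kernel. -/
theorem exists_isCentralLift [Finite Γ] [Finite H] [Finite G] [Finite K]
    (S : GroupExtension H G K) (e : G ≃* H × K) (φ : Γ →* K) : ∃ ψ, S.IsCentralLift φ ψ := by
  by_contra hφ
  have : Finite (Γ →* K) := DFunLike.finite _
  have : Finite (Γ →* G) := DFunLike.finite _
  obtain ⟨φ, hφ, hmax⟩ := Set.exists_max_image {φ : Γ →* K | ¬∃ ψ, S.IsCentralLift φ ψ}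
    (fun φ => Nat.card (rangeCentralizer φ)) (Set.toFinite _) ⟨φ, hφ⟩
  simp only [Set.mem_ofPred_eq] at hφ hmax
  set d := Nat.card (rangeCentralizer φ) with hd
  have hd0 : 0 < d := Nat.card_pos
  have hlift : ∀ ψ : Γ →* G, Nat.card H * d ≤ Nat.card (rangeCentralizer ψ) →
      ∃ ψ₀, S.IsCentralLift (S.rightHom.comp ψ) ψ₀ := by
    intro ψ hψ
    by_contra hno
    -- By maximality the centralizer in `K` has order at most `d`, so all of `H` must centralize
    -- `ψ`, and `ψ` is its own central lift.
    refine hno ⟨ψ, isCentralLift_of_comap_rangeCentralizer_eq_top ?_⟩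
    refine Subgroup.eq_top_of_le_card _ (Nat.le_of_mul_le_mul_right ?_ hd0)
    exact hψ.trans ((S.card_rangeCentralizer_le ψ).trans (Nat.mul_le_mul_left _ (hmax _ hno)))
  have hchoice : ∀ χ : Γ →* K, ∃ ψ₀ : Γ →* G,
      (∃ ψ, S.IsCentralLift χ ψ) → S.IsCentralLift χ ψ₀ := by
    intro χ
    by_cases h : ∃ ψ, S.IsCentralLift χ ψ
    · exact ⟨h.choose, fun _ => h.choose_spec⟩
    · exact ⟨1, fun h' => absurd h' h⟩
  choose σ hσ using hchoice
  let A := {ψ : Γ →* G // Nat.card H * d ≤ Nat.card (rangeCentralizer ψ)}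
  let B := {χ : Γ →* H × K // Nat.card H * d ≤ Nat.card (rangeCentralizer χ)}
  have htwist : ∀ ψ : A, ∃ a : Γ →* H,
      ∀ x, ψ.1 x = S.inl (a x) * σ (S.rightHom.comp ψ.1) x := fun ψ =>
    (hσ _ (hlift ψ.1 ψ.2)).exists_eq_inl_mul rfl
  choose a ha using htwist
  have hB : ∀ ψ : A,
      Nat.card H * d ≤ Nat.card (rangeCentralizer ((a ψ).prod (S.rightHom.comp ψ.1))) := by
    intro ψ
    rw [card_rangeCentralizer_prod,
      ← (hσ _ (hlift ψ.1 ψ.2)).comap_rangeCentralizer (ha ψ)]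
    exact ψ.2.trans (S.card_rangeCentralizer_le ψ.1)
  let F : A → B := fun ψ => ⟨(a ψ).prod (S.rightHom.comp ψ.1), hB ψ⟩
  have hF : Function.Injective F := by
    intro ψ ψ' h
    have h' : (a ψ).prod (S.rightHom.comp ψ.1) = (a ψ').prod (S.rightHom.comp ψ'.1) :=
      congrArg Subtype.val h
    have h1 : a ψ = a ψ' := by
      simpa using congrArg ((MonoidHom.fst H K).comp ·) h'
    have h2 : S.rightHom.comp ψ.1 = S.rightHom.comp ψ'.1 := by
      simpa using congrArg ((MonoidHom.snd H K).comp ·) h'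
    refine Subtype.ext (MonoidHom.ext fun x => ?_)
    rw [ha ψ, ha ψ', h1, h2]
  have : Finite A := Subtype.finite
  let E : A ≃ B := (e.monoidHomCongrRightEquiv : (Γ →* G) ≃ (Γ →* H × K)).subtypeEquiv
    fun ψ => by
      change _ ↔ _ ≤ Nat.card (rangeCentralizer (e.toMonoidHom.comp ψ))
      rw [card_rangeCentralizer_mulEquiv_comp]
  -- The bound `|H| * d` is exactly the order of the centralizer of `(1, φ)`.
  have hone : Nat.card H * d ≤ Nat.card (rangeCentralizer ((1 : Γ →* H).prod φ)) := by
    rw [card_rangeCentralizer_prod, rangeCentralizer_one, Subgroup.card_top]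
  obtain ⟨ψ, hψ⟩ := hF.surjective_of_finite E ⟨_, hone⟩
  have hψφ : S.rightHom.comp ψ.1 = φ := by
    simpa [F] using congrArg (fun χ : B => (MonoidHom.snd H K).comp χ.1) hψ
  exact hφ (hψφ ▸ hlift ψ.1 ψ.2)

/-- A central lift of the identity is a section commuting with `H`, so `(h, k) ↦ S.inl h * ψ k` is a
homomorphism and an equivalence of extensions. -/
theorem IsCentralLift.isDirectExtension {S : GroupExtension H G K} {ψ : K →* G}
    (hψ : S.IsCentralLift (MonoidHom.id K) ψ) : IsDirectExtension S := by
  let f : H × K →* G := S.inl.noncommCoprod ψ fun h k => (hψ.commute k h).symm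
  refine ⟨(Equiv.ofMonoidHom (S := prodExtension H K) (S' := S) f ?_ ?_).symm⟩
  · ext h
    simp [f, prodExtension]
  · ext ⟨h, k⟩
    simpa [f, prodExtension] using DFunLike.congr_fun hψ.rightHom_comp k

/-- The extension `1 → N → G → G ⧸ N → 1` with its ends replaced by isomorphic groups. -/
def ofNormal (N : Subgroup G) [N.Normal] (e : H ≃* N) (q : G ⧸ N ≃* K) : GroupExtension H G K where
  inl := N.subtype.comp e.toMonoidHom
  rightHom := q.toMonoidHom.comp (QuotientGroup.mk' N)
  inl_injective := N.subtype_injective.comp e.injective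
  range_inl_eq_ker_rightHom := by
    rw [MonoidHom.range_comp]
    refine Eq.trans ?_ (MonoidHom.ker_mulEquiv_comp (QuotientGroup.mk' N) q).symm
    rw [MonoidHom.range_eq_top.2 (show Function.Surjective e.toMonoidHom from e.surjective),
      ← MonoidHom.range_eq_map, Subgroup.range_subtype, QuotientGroup.ker_mk']
  rightHom_surjective := q.surjective.comp (QuotientGroup.mk'_surjective N)

end GroupExtension

theorem IsDirectDecomposition.nonempty_mulEquiv_prod {G : Type*} [Group G] {H K : Subgroup G}
    (h : IsDirectDecomposition H K) : Nonempty (G ≃* H × K) := by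
  have := h.normal_left
  have := h.normal_right
  have hd : Disjoint H K := disjoint_iff.2 h.inf_eq_bot
  have hc : ∀ (x : H) (y : K), Commute (H.subtype x) (K.subtype y) := fun x y =>
    Subgroup.commute_of_normal_of_disjoint H K ‹_› ‹_› hd x y x.2 y.2
  refine ⟨(MulEquiv.ofBijective (H.subtype.noncommCoprod K.subtype hc) ⟨?_, fun g => ?_⟩).symm⟩
  · rw [MonoidHom.noncommCoprod_injective]
    simpa using hd
  · obtain ⟨x, hx, y, hy, rfl⟩ := h.mul_eq g
    exact ⟨(⟨x, hx⟩, ⟨y, hy⟩), rfl⟩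

/-- The kernel of a direct extension is a direct factor. -/
theorem IsDirectExtension.exists_isDirectDecomposition {H G K : Type*} [Group H] [Group G]
    [Group K] {S : GroupExtension H G K} (h : IsDirectExtension S) :
    ∃ L : Subgroup G, IsDirectDecomposition S.inl.range L := by
  obtain ⟨θ⟩ := h
  -- The retraction of `G` onto `H` given by `θ`; its kernel is the complement.
  let p : G →* H := (MonoidHom.fst H K).comp θ.toMulEquiv.toMonoidHom
  have hp : ∀ x, p (S.inl x) = x := fun x => congrArg Prod.fst (θ.map_inl x)
  have hπ : ∀ g, (θ g).2 = S.rightHom g := θ.rightHom_map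
  refine ⟨p.ker, inferInstance, inferInstance, fun g => ?_, ?_⟩
  · exact ⟨S.inl (p g), ⟨_, rfl⟩, (S.inl (p g))⁻¹ * g, by simp [MonoidHom.mem_ker, hp], by simp⟩
  · rw [eq_bot_iff]
    rintro _ ⟨⟨x, rfl⟩, hx⟩
    have hx' : p (S.inl x) = 1 := hx
    rw [hp] at hx'
    simp [hx']

theorem isDirectExtension_of_mulEquiv_prod {G H K : Type*} [Group G] [Group H] [Group K]
    [Finite G] [Finite H] [Finite K] (e : G ≃* H × K) (S : GroupExtension H G K) :
    IsDirectExtension S :=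
  (S.exists_isCentralLift e (MonoidHom.id K)).choose_spec.isDirectExtension

theorem theorem1 :
    (∀ (G H K : Type*) [Group G] [Group H] [Group K]
        [Finite G] [Finite H] [Finite K],
        Nonempty (G ≃* H × K) →
        ∀ S : GroupExtension H G K, IsDirectExtension S) ∧
    (∀ (G : Type*) [Group G] [Finite G] (H K : Subgroup G),
        IsDirectDecomposition H K →
        ∀ (H₀ : Subgroup G) [H₀.Normal],
        Nonempty (H₀ ≃* H) → Nonempty (G ⧸ H₀ ≃* K) →
        ∃ K₀ : Subgroup G, IsDirectDecomposition H₀ K₀) := by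
  refine ⟨fun G H K _ _ _ _ _ _ ⟨e⟩ S => isDirectExtension_of_mulEquiv_prod e S, ?_⟩
  intro G _ _ H K hHK H₀ _ ⟨e⟩ ⟨q⟩
  obtain ⟨f⟩ := hHK.nonempty_mulEquiv_prod
  let S := GroupExtension.ofNormal H₀ e.symm q
  obtain ⟨L, hL⟩ := (isDirectExtension_of_mulEquiv_prod f S).exists_isDirectDecomposition
  have hS : S.inl.range = H₀ := by
    rw [S.range_inl_eq_ker_rightHom]
    simp [S, GroupExtension.ofNormal]
  exact ⟨L, hS ▸ hL⟩
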